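/- Fix an integer $H\ge 1$ and constants $c,b,p,w_{\max}$ with $c>0$, $b>0$ and $p>c$. Let $w_1,\dots,w_{H-1}$ be independent real random variables with values in $[0,w_{\max}]$ (not necessarily identically distributed), each with a continuous distribution, i.e. $\mathbb P(w_t=x)=0$ for every $x\in\mathbb R$. For $\theta=(\theta_1,\dots,\theta_H)\in\mathbb R^H$, $h\in\{1,\dots,H\}$ and $s\in\mathbb R$, consider the inventory started at $s_h=s$ and evolving by $$s_{t+1}=s_t+a_t-w_t,\qquad a_t=\max\{0,\theta_t-s_t\},\qquad t=h,\dots,H-1,$$ (backlogged demand, base-stock policy with levels $\theta$) and put $$J_\theta((h,s))=\mathbb E\sum_{t=h}^{H-1}\Big(c\,a_t+b\max\{s_t+a_t-w_t,0\}+p\max\{-(s_t+a_t-w_t),0\}\Big).$$ Let $\rho$ be a probability distribution on $\{1,\dots,H\}\times\mathbb R$ whose support is all of $\{1,\dots,H\}\times\mathbb R$ (every non-empty open set has positive mass), such that for each $h$ all moments of the marginal $\rho(h,\cdot)$ exist, and set $\ell(\theta)=\mathbb E_{(h,s)\sim\rho}[J_\theta((h,s))]$. Then for every $\theta\in\mathbb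 R^H$, $$\ell\ \text{is differentiable at}\ \theta\ \text{with}\ \nabla\ell(\theta)=0\quad\Longleftrightarrow\quad \ell(\theta)=\min_{\theta'\in\mathbb R^H}\ell(\theta').$$ -/

import Mathlib

open MeasureTheory ProbabilityTheory

noncomputable section

namespace Newsvendor

/-- The quantity ordered by a base-stock policy with target `level` when the inventory is `s`. -/
def order (level s : ℝ) : ℝ := max 0 (level - s)

/-- The holding and backlogging cost of the inventory `x` left at the end of a period:
`b` per unit held and `p` per unit backlogged. -/
def holdingCost (b p x : ℝ) : ℝ := b * max x 0 + p * max (-x) 0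

/-- The inventory `s_t` in period `t`, for `t ≥ h`, when it is `s` in period `h`, the target levels
are `θ` and the realized demands are `w`: `s_h = s` and `s_{t+1} = s_t + a_t - w_t` with
`a_t = max 0 (θ_t - s_t)`. (For `t < h` the value is `s`; it is never used.) -/
def inventory (θ w : ℕ → ℝ) (h : ℕ) (s : ℝ) : ℕ → ℝ
  | 0 => s
  | t + 1 =>
      if t + 1 ≤ h then s
      else
        inventory θ w h s t + order (θ t) (inventory θ w h s t) - w t

/-- The cost incurred in periods `h, …, H - 1` along the realized demands `w`. -/
def pathCost (c b p : ℝ) (H : ℕ) (θ w : ℕ → ℝ) (h : ℕ) (s : ℝ) : ℝ :=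
  ∑ t ∈ Finset.Ico h H,
    (c * order (θ t) (inventory θ w h s t)
      + holdingCost b p
          (inventory θ w h s t + order (θ t) (inventory θ w h s t) - w t))

/-- The coordinate `θ_t` of `θ = (θ_1, …, θ_H)`, as a function of the natural number `t`
(zero outside `{1, …, H}`). -/
def level {H : ℕ} (θ : EuclideanSpace ℝ (Finset.Icc 1 H)) (t : ℕ) : ℝ :=
  if ht : t ∈ Finset.Icc 1 H then θ ⟨t, ht⟩ else 0

/-- The expected cost-to-go `J_θ((h, s))` of the base-stock policy with levels `θ`. -/
def costToGo {Ω : Type*} [MeasurableSpace Ω] (P : Measure Ω) (W : ℕ → Ω → ℝ) (c b p : ℝ) {H : ℕ}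
    (θ : EuclideanSpace ℝ (Finset.Icc 1 H)) (h : ℕ) (s : ℝ) : ℝ :=
  ∫ ω, pathCost c b p H (level θ) (fun t => W t ω) h s ∂P

/-- The objective `ℓ(θ)`, the mean of `J_θ((h, s))` over `(h, s) ∼ ρ`. -/
def loss {Ω : Type*} [MeasurableSpace Ω] (P : Measure Ω) (W : ℕ → Ω → ℝ) (c b p : ℝ) {H : ℕ}
    (ρ : Measure (Finset.Icc 1 H × ℝ)) (θ : EuclideanSpace ℝ (Finset.Icc 1 H)) : ℝ :=
  ∫ z, costToGo P W c b p θ z.1 z.2 ∂ρ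

/-- The (sub-probability) distribution `ρ(h, ·)` of the initial inventory on the event that the
initial period is `h`. -/
def periodMarginal {H : ℕ} (ρ : Measure (Finset.Icc 1 H × ℝ)) (h : Finset.Icc 1 H) : Measure ℝ :=
  (ρ.restrict {z | z.1 = h}).snd

end Newsvendor

end

/-!
For levels `a`, let `V_h(s)` be the expected cost from period `h` on, and let
`G_h(y) = c * y + E[L(y - W_h) + V_{h+1}(y - W_h)]`, where `L` is the holding and backlogging cost.
By independence of the demands, `V_h(s) = G_h(max s a_h) - c * s` (`IsDemand.value_eq`). All these
functions are Lipschitz, which gives every integrability statement needed.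

Call the levels stationary if `G_t'(a_t) = 0` for all `t < H`. Both sides of the equivalence are
shown to be equivalent to stationarity.

Suppose that the levels are stationary. Going backwards in time, each `V_h` is convex and
differentiable (`IsDemand.convexOn_differentiable_value`): the function `s ↦ G_h(max s a_h)` has no
kink at `a_h`, and averaging over an atomless demand removes the kink of `L`. So `a_t` minimizes the
convex function `G_t`, and for any other levels `a'`
`0 ≤ V'_h(s) - V_h(s) ≤ ∑_{t ≥ h} (G_t(a'_t) - G_t(a_t))` (`IsDemand.value_sub_mem_Icc`).
The bounds do not depend on `s`, so they hold for the loss as well. The lower bound says that the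
levels are optimal, and since the upper bound is `o(‖a' - a‖)`, the gradient is zero
(`IsDemand.hasGradientAt_loss_zero`).

Conversely, a minimum and a vanishing gradient both imply that the loss does not decrease linearly
in any direction, and this implies stationarity (`IsDemand.isStationaryFrom_of_loss`). Indeed, let
the levels after period `t` be stationary, so that `G_t` is differentiable, and suppose that
`g = G_t'(a_t)` is not zero. Replace `a_t` by `a_t - ε * g`. For every initial state the cost
increases by at most `o(ε)`, and for an initial inventory below `a_t - 1` in period `t`, an event of
positive probability because `ρ` charges open sets, it decreases by `ε * g ^ 2` up to `o(ε)`. So the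
loss decreases linearly in `ε`, a contradiction.
-/

noncomputable section

namespace Newsvendor

/-! ### Pathwise recursion for the cost -/

theorem add_order (l s : ℝ) : s + order l s = max s l := by
  rw [order, ← max_add_add_left, add_zero, add_sub_cancel]

theorem inventory_of_le (a w : ℕ → ℝ) (h : ℕ) (s : ℝ) {t : ℕ} (ht : t ≤ h) :
    inventory a w h s t = s := by
  cases t with
  | zero => rfl
  | succ t => rw [inventory, if_pos ht]

theorem inventory_succ (a w : ℕ → ℝ) (h : ℕ) (s : ℝ) {t : ℕ} (ht : h ≤ t) :
    inventory a w h s (t + 1) = max (inventory a w h s t) (a t) - w t := by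
  rw [inventory, if_neg (by omega), add_order]

theorem inventory_restart (a w : ℕ → ℝ) (h : ℕ) (s : ℝ) {t : ℕ} (ht : h + 1 ≤ t) :
    inventory a w h s t = inventory a w (h + 1) (max s (a h) - w h) t := by
  induction t, ht using Nat.le_induction with
  | base => rw [inventory_succ _ _ _ _ le_rfl, inventory_of_le _ _ _ _ le_rfl,
      inventory_of_le _ _ _ _ le_rfl]
  | succ t ht ih => rw [inventory_succ _ _ _ _ (by omega), inventory_succ _ _ _ _ ht, ih]

theorem inventory_congr {a a' w w' : ℕ → ℝ} {h : ℕ} (s : ℝ) {t : ℕ}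
    (ha : ∀ i, h ≤ i → i < t → a i = a' i) (hw : ∀ i, h ≤ i → i < t → w i = w' i) :
    inventory a w h s t = inventory a' w' h s t := by
  induction t with
  | zero => rfl
  | succ t ih =>
    rcases Nat.lt_or_ge t h with hth | hth
    · rw [inventory_of_le _ _ _ _ hth, inventory_of_le _ _ _ _ hth]
    · rw [inventory_succ _ _ _ _ hth, inventory_succ _ _ _ _ hth, ha t hth t.lt_succ_self,
        hw t hth t.lt_succ_self, ih (fun i hi hit => ha i hi (by omega))
          (fun i hi hit => hw i hi (by omega))]

/-- The cost from period `h` on depends only on the levels and demands of the periods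
`h, …, H - 1`. -/
theorem pathCost_congr (c b p : ℝ) {H : ℕ} {a a' w w' : ℕ → ℝ} {h : ℕ} (s : ℝ)
    (ha : ∀ i ∈ Finset.Ico h H, a i = a' i) (hw : ∀ i ∈ Finset.Ico h H, w i = w' i) :
    pathCost c b p H a w h s = pathCost c b p H a' w' h s := by
  refine Finset.sum_congr rfl fun t ht => ?_
  have ht' := Finset.mem_Ico.1 ht
  rw [ha t ht, hw t ht, inventory_congr s
    (fun i hi hit => ha i (Finset.mem_Ico.2 ⟨hi, hit.trans ht'.2⟩))
    (fun i hi hit => hw i (Finset.mem_Ico.2 ⟨hi, hit.trans ht'.2⟩))]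

theorem pathCost_succ (c b p : ℝ) {H : ℕ} (a w : ℕ → ℝ) {h : ℕ} (hh : h < H) (s : ℝ) :
    pathCost c b p H a w h s = c * (max s (a h) - s) + holdingCost b p (max s (a h) - w h)
      + pathCost c b p H a w (h + 1) (max s (a h) - w h) := by
  rw [pathCost, Finset.sum_eq_sum_Ico_succ_bot hh, inventory_of_le _ _ _ _ le_rfl, add_order,
    pathCost]
  congr 1
  · rw [← add_order (a h) s, add_sub_cancel_left]
  · refine Finset.sum_congr rfl fun t ht => ?_
    rw [inventory_restart a w h s (Finset.mem_Ico.1 ht).1]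

theorem continuous_holdingCost (b p : ℝ) : Continuous (holdingCost b p) := by
  unfold holdingCost; fun_prop

theorem continuous_inventory (a : ℕ → ℝ) (h t : ℕ) :
    Continuous fun x : ℝ × (ℕ → ℝ) => inventory a x.2 h x.1 t := by
  induction t with
  | zero => exact continuous_fst
  | succ t ih =>
    rcases Nat.lt_or_ge t h with hth | hth
    · simpa only [inventory_of_le _ _ _ _ hth] using continuous_fst
    · simp only [inventory_succ _ _ _ _ hth]
      fun_prop

theorem continuous_pathCost (c b p : ℝ) (H : ℕ) (a : ℕ → ℝ) (h : ℕ) :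
    Continuous fun x : ℝ × (ℕ → ℝ) => pathCost c b p H a x.2 h x.1 := by
  unfold pathCost order
  refine continuous_finsetSum _ fun t _ => ?_
  have h1 := continuous_inventory a h t
  have h2 := continuous_holdingCost b p
  fun_prop

/-! ### Dynamic programming equation -/

variable {Ω : Type*} [MeasurableSpace Ω]

/-- The demands `W_1, …, W_{H-1}` are independent, take values in `[0, wmax]`, and have no atoms.
No condition is put on `W t` for other `t`. -/
structure IsDemand (P : Measure Ω) (H : ℕ) (wmax : ℝ) (W : ℕ → Ω → ℝ) : Prop where
  measurable : ∀ t ∈ Finset.Ico 1 H, Measurable (W t)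
  mem_Icc : ∀ t ∈ Finset.Ico 1 H, ∀ᵐ ω ∂P, W t ω ∈ Set.Icc 0 wmax
  measure_eq_zero : ∀ t ∈ Finset.Ico 1 H, ∀ x : ℝ, P {ω | W t ω = x} = 0
  indep : iIndepFun (fun (t : Finset.Ico 1 H) => W t) P

/-- The demands in the periods `h, …, H - 1`, extended by zero. -/
def tail (W : ℕ → Ω → ℝ) (h H : ℕ) (ω : Ω) (t : ℕ) : ℝ :=
  if t ∈ Finset.Ico h H then W t ω else 0

/-- The expected cost from period `h` on, with levels indexed by the natural numbers. -/
def value (P : Measure Ω) (W : ℕ → Ω → ℝ) (c b p : ℝ) (H : ℕ) (a : ℕ → ℝ) (h : ℕ) (s : ℝ) : ℝ :=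
  ∫ ω, pathCost c b p H a (fun t => W t ω) h s ∂P

/-- The cost, as a function of the inventory `x` at the end of period `h`, of holding it and of
continuing from it. -/
def endCost (P : Measure Ω) (W : ℕ → Ω → ℝ) (c b p : ℝ) (H : ℕ) (a : ℕ → ℝ) (h : ℕ) (x : ℝ) : ℝ :=
  holdingCost b p x + value P W c b p H a (h + 1) x

/-- The expected cost from period `h` on when the order raises the inventory to `y`, with the
ordering cost counted as `c * y`, that is, as if the inventory had been zero. -/
def orderUpToCost (P : Measure Ω) (W : ℕ → Ω → ℝ) (c b p : ℝ) (H : ℕ) (a : ℕ → ℝ) (h : ℕ)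
    (y : ℝ) : ℝ :=
  c * y + ∫ ω, endCost P W c b p H a h (y - W h ω) ∂P

variable {P : Measure Ω} {H : ℕ} {wmax : ℝ} {W : ℕ → Ω → ℝ} {c b p : ℝ}

theorem value_eq_tail (a : ℕ → ℝ) (h : ℕ) (s : ℝ) :
    value P W c b p H a h s = ∫ ω, pathCost c b p H a (tail W h H ω) h s ∂P := by
  refine integral_congr_ae (.of_forall fun ω => ?_)
  exact pathCost_congr c b p s (fun _ _ => rfl) fun i hi => (if_pos hi).symm

theorem value_congr {a a' : ℕ → ℝ} {h : ℕ} (s : ℝ) (ha : ∀ i ∈ Finset.Ico h H, a i = a' i) :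
    value P W c b p H a h s = value P W c b p H a' h s :=
  integral_congr_ae (.of_forall fun _ => pathCost_congr c b p s ha fun _ _ => rfl)

theorem value_terminal (a : ℕ → ℝ) (s : ℝ) : value P W c b p H a H s = 0 := by
  simp [value, pathCost]

namespace IsDemand

theorem measurable_tail (hW : IsDemand P H wmax W) {h : ℕ} (hh : 1 ≤ h) :
    Measurable (tail W h H) := by
  refine measurable_pi_iff.2 fun t => ?_
  unfold tail
  split_ifs with ht
  · exact hW.measurable t (Finset.Ico_subset_Ico_left hh ht)
  · exact measurable_const

theorem indepFun_tail (hW : IsDemand P H wmax W) {h : ℕ} (hh : h ∈ Finset.Ico 1 H) :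
    IndepFun (W h) (tail W (h + 1) H) P := by
  have h1 := Finset.mem_Ico.1 hh
  have hind := hW.indep.indepFun_finset {⟨h, hh⟩}
    (Finset.univ.filter fun t : Finset.Ico 1 H => h < t)
    (by simp) (fun t => hW.measurable t t.2)
  let φ (x : ({⟨h, hh⟩} : Finset (Finset.Ico 1 H)) → ℝ) : ℝ := x ⟨⟨h, hh⟩, by simp⟩
  let ψ (x : (Finset.univ.filter fun t : Finset.Ico 1 H => h < t) → ℝ) (t : ℕ) : ℝ :=
    if ht : t ∈ Finset.Ico (h + 1) H then
      x ⟨⟨t, by simp only [Finset.mem_Ico] at ht ⊢; omega⟩, by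
        simp only [Finset.mem_Ico] at ht; simp; omega⟩
    else 0
  have hφ : Measurable φ := measurable_pi_apply _
  have hψ : Measurable ψ := measurable_pi_iff.2 fun t => by
    by_cases ht : t ∈ Finset.Ico (h + 1) H
    · simp only [ψ, dif_pos ht]; exact measurable_pi_apply _
    · simp only [ψ, dif_neg ht]; exact measurable_const
  exact hind.comp hφ hψ

variable [IsProbabilityMeasure P]

/-- The demands lie in a compact box of `ℕ → ℝ`, so a continuous function of them is
integrable. -/
theorem integrable_comp_tail (hW : IsDemand P H wmax W) {h : ℕ} (hh : 1 ≤ h) {F : (ℕ → ℝ) → ℝ}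
    (hF : Continuous F) : Integrable (fun ω => F (tail W h H ω)) P := by
  obtain ⟨C, hC⟩ := (isCompact_univ_pi (X := fun _ : ℕ => ℝ)
    fun _ => isCompact_Icc (a := 0) (b := max wmax 0)).exists_bound_of_continuousOn hF.continuousOn
  refine Integrable.of_bound
    (hF.measurable.comp (hW.measurable_tail hh)).aestronglyMeasurable C ?_
  have hall : ∀ᵐ ω ∂P, ∀ t, t ∈ Finset.Ico 1 H → W t ω ∈ Set.Icc 0 wmax := by
    rw [ae_all_iff]
    intro t
    by_cases ht : t ∈ Finset.Ico 1 H
    · filter_upwards [hW.mem_Icc t ht] with ω hω _ using hω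
    · exact .of_forall fun ω hh => absurd hh ht
  filter_upwards [hall] with ω hω
  refine hC _ fun t _ => ?_
  unfold tail
  split_ifs with ht
  · have := hω t (Finset.Ico_subset_Ico_left hh ht)
    exact ⟨this.1, this.2.trans (le_max_left _ _)⟩
  · exact ⟨le_rfl, le_max_right _ _⟩

/-- Conditioning on the demand of period `h`: by independence, it may be integrated separately
from the later demands. -/
theorem integral_freeze (hW : IsDemand P H wmax W) {h : ℕ} (hh : h ∈ Finset.Ico 1 H)
    {F : ℝ × (ℕ → ℝ) → ℝ} (hF : Continuous F)
    (hint : Integrable (fun ω => F (W h ω, tail W (h + 1) H ω)) P) :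
    Integrable (fun ω => ∫ ω', F (W h ω, tail W (h + 1) H ω') ∂P) P ∧
      ∫ ω, F (W h ω, tail W (h + 1) H ω) ∂P =
        ∫ ω, ∫ ω', F (W h ω, tail W (h + 1) H ω') ∂P ∂P := by
  have hm := hW.measurable h hh
  have ht := hW.measurable_tail (h := h + 1) (by omega)
  have hmap := (indepFun_iff_map_prod_eq_prod_map_map hm.aemeasurable ht.aemeasurable).1
    (hW.indepFun_tail hh)
  have hFm := hF.measurable
  have := Measure.isProbabilityMeasure_map (μ := P) hm.aemeasurable
  have := Measure.isProbabilityMeasure_map (μ := P) ht.aemeasurable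
  have hint' : Integrable F ((P.map (W h)).prod (P.map (tail W (h + 1) H))) := by
    rw [← hmap, integrable_map_measure hFm.aestronglyMeasurable (hm.prodMk ht).aemeasurable]
    exact hint
  have hinner (ω : Ω) : ∫ y, F (W h ω, y) ∂(P.map (tail W (h + 1) H))
      = ∫ ω', F (W h ω, tail W (h + 1) H ω') ∂P :=
    integral_map ht.aemeasurable
      (hFm.comp (measurable_const.prodMk measurable_id)).aestronglyMeasurable
  have hmarg := hint'.integral_prod_left
  refine ⟨?_, ?_⟩
  · have := (integrable_map_measure hmarg.aestronglyMeasurable hm.aemeasurable).1 hmarg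
    exact this.congr (.of_forall hinner)
  calc ∫ ω, F (W h ω, tail W (h + 1) H ω) ∂P
      = ∫ z, F z ∂(P.map fun ω => (W h ω, tail W (h + 1) H ω)) :=
        (integral_map (hm.prodMk ht).aemeasurable hFm.aestronglyMeasurable).symm
    _ = ∫ x, ∫ y, F (x, y) ∂(P.map (tail W (h + 1) H)) ∂(P.map (W h)) := by
        rw [hmap, integral_prod _ hint']
    _ = ∫ ω, ∫ y, F (W h ω, y) ∂(P.map (tail W (h + 1) H)) ∂P :=
        integral_map hm.aemeasurable hmarg.aestronglyMeasurable
    _ = _ := integral_congr_ae (.of_forall hinner)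

end IsDemand

variable [IsProbabilityMeasure P]

theorem IsDemand.value_eq (hW : IsDemand P H wmax W) (a : ℕ → ℝ) {h : ℕ}
    (hh : h ∈ Finset.Ico 1 H) (s : ℝ) :
    value P W c b p H a h s = orderUpToCost P W c b p H a h (max s (a h)) - c * s := by
  have h1 := Finset.mem_Ico.1 hh
  set y := max s (a h)
  have hL : Continuous (holdingCost b p) := continuous_holdingCost b p
  have hC := continuous_pathCost c b p H a (h + 1)
  have hcur (ω : Ω) : tail W h H ω h = W h ω := if_pos (Finset.mem_Ico.2 ⟨le_rfl, h1.2⟩)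
  have hnext (ω : Ω) (x : ℝ) : pathCost c b p H a (tail W h H ω) (h + 1) x
      = pathCost c b p H a (tail W (h + 1) H ω) (h + 1) x := by
    refine pathCost_congr c b p x (fun _ _ => rfl) fun i hi => ?_
    have hi' := Finset.mem_Ico.1 hi
    rw [tail, tail, if_pos hi, if_pos (Finset.mem_Ico.2 ⟨by omega, hi'.2⟩)]
  have hiL : Integrable (fun ω => holdingCost b p (y - W h ω)) P := by
    have := hW.integrable_comp_tail h1.1 (F := fun w => holdingCost b p (y - w h)) (by fun_prop)
    simpa only [hcur] using this
  have hiC : Integrable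
      (fun ω => pathCost c b p H a (tail W (h + 1) H ω) (h + 1) (y - W h ω)) P := by
    have := hW.integrable_comp_tail h1.1 (F := fun w => pathCost c b p H a w (h + 1) (y - w h))
      (hC.comp (f := fun w : ℕ → ℝ => (y - w h, w)) (by fun_prop))
    simpa only [hcur, hnext] using this
  have hF : Continuous
      fun x : ℝ × (ℕ → ℝ) => pathCost c b p H a x.2 (h + 1) (y - x.1) :=
    hC.comp (f := fun x : ℝ × (ℕ → ℝ) => (y - x.1, x.2)) (by fun_prop)
  obtain ⟨hiV, hfr⟩ := hW.integral_freeze hh hF hiC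
  simp only [← value_eq_tail] at hiV hfr
  calc value P W c b p H a h s
      = ∫ ω, (c * (y - s) + holdingCost b p (y - W h ω)
          + pathCost c b p H a (tail W (h + 1) H ω) (h + 1) (y - W h ω)) ∂P := by
        rw [value_eq_tail]
        refine integral_congr_ae (.of_forall fun ω => ?_)
        simp only [pathCost_succ c b p a _ h1.2, hcur, hnext, y]
    _ = c * (y - s) + ∫ ω, holdingCost b p (y - W h ω) ∂P
          + ∫ ω, pathCost c b p H a (tail W (h + 1) H ω) (h + 1) (y - W h ω) ∂P := by
        have hi1 := (integrable_const (μ := P) (c * (y - s))).add hiL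
        simp only [Pi.add_def] at hi1
        rw [integral_add hi1 hiC,
          integral_add (integrable_const _) hiL]
        simp
    _ = c * (y - s) + ∫ ω, holdingCost b p (y - W h ω) ∂P
          + ∫ ω, value P W c b p H a (h + 1) (y - W h ω) ∂P := by
        rw [hfr]
    _ = _ := by
        simp only [orderUpToCost, endCost]
        rw [integral_add hiL hiV]
        ring

end Newsvendor

namespace Newsvendor

/-! ### Averages of translates -/

section Translates

variable {Ω : Type*} [MeasurableSpace Ω] {P : Measure Ω} {X : Ω → ℝ}
  {F : ℝ → ℝ} {K : NNReal}

theorem integrable_comp_const_sub [IsFiniteMeasure P] (hX : Integrable X P)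
    (hF : LipschitzWith K F) (y : ℝ) :
    Integrable (fun ω => F (y - X ω)) P := by
  have hbound : Integrable (fun ω => |F y| + K * |X ω|) P :=
    (integrable_const _).add (hX.abs.const_mul _)
  refine hbound.mono' (hF.continuous.comp_aestronglyMeasurable
    (aestronglyMeasurable_const.sub hX.aestronglyMeasurable)) (.of_forall fun ω => ?_)
  have := hF.dist_le_mul (y - X ω) y
  rw [Real.dist_eq, Real.dist_eq, sub_sub_cancel_left, abs_neg] at this
  have h2 := abs_sub_abs_le_abs_sub (F (y - X ω)) (F y)
  rw [Real.norm_eq_abs]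
  linarith

variable [IsProbabilityMeasure P]

theorem lipschitzWith_integral_comp_const_sub (hX : Integrable X P) (hF : LipschitzWith K F) :
    LipschitzWith K fun y => ∫ ω, F (y - X ω) ∂P := by
  refine LipschitzWith.of_dist_le_mul fun x y => ?_
  rw [dist_eq_norm, ← integral_sub (integrable_comp_const_sub hX hF x)
    (integrable_comp_const_sub hX hF y)]
  refine (norm_integral_le_of_norm_le_const (C := K * dist x y) (.of_forall fun ω => ?_)).trans
    (by simp)
  rw [← dist_eq_norm]
  simpa [Real.dist_eq] using hF.dist_le_mul (x - X ω) (y - X ω)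

theorem convexOn_integral_comp_const_sub (hX : Integrable X P) (hF : LipschitzWith K F)
    (hconv : ConvexOn ℝ Set.univ F) :
    ConvexOn ℝ Set.univ fun y => ∫ ω, F (y - X ω) ∂P := by
  refine ⟨convex_univ, fun x _ y _ α β hα hβ hαβ => ?_⟩
  have hx := (integrable_comp_const_sub hX hF x).const_mul α
  have hy := (integrable_comp_const_sub hX hF y).const_mul β
  simp only [smul_eq_mul]
  rw [← integral_const_mul, ← integral_const_mul, ← integral_add hx hy]
  refine integral_mono (integrable_comp_const_sub hX hF _) (hx.add hy) fun ω => ?_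
  have := hconv.2 (Set.mem_univ (x - X ω)) (Set.mem_univ (y - X ω)) hα hβ hαβ
  simp only [smul_eq_mul] at this
  have h2 : α * (x - X ω) + β * (y - X ω) = α * x + β * y - X ω := by
    linear_combination (-X ω) * hαβ
  rwa [h2] at this

/-- Averaging against an atomless distribution smooths out the kink at zero. -/
theorem differentiable_integral_comp_const_sub (hX : Integrable X P)
    (hX0 : ∀ x, P {ω | X ω = x} = 0) (hF : LipschitzWith K F)
    (hd : ∀ x ≠ 0, DifferentiableAt ℝ F x) :
    Differentiable ℝ fun y => ∫ ω, F (y - X ω) ∂P := by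
  intro y
  have hmeas (x : ℝ) : AEStronglyMeasurable (fun ω => x - X ω) P :=
    aestronglyMeasurable_const.sub hX.aestronglyMeasurable
  refine (hasDerivAt_integral_of_dominated_loc_of_lip (F := fun y ω => F (y - X ω))
    (F' := fun ω => deriv F (y - X ω)) (bound := fun _ => K) (s := Set.univ) Filter.univ_mem
    (.of_forall fun x => (integrable_comp_const_sub hX hF x).aestronglyMeasurable)
    (integrable_comp_const_sub hX hF y)
    ((measurable_deriv F).comp_aemeasurable (hmeas y).aemeasurable).aestronglyMeasurable
    (.of_forall fun ω => ?_) (integrable_const _) ?_).2.differentiableAt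
  · refine LipschitzWith.lipschitzOnWith (LipschitzWith.of_dist_le_mul fun u v => ?_)
    simpa [Real.dist_eq] using hF.dist_le_mul (u - X ω) (v - X ω)
  · have hne : ∀ᵐ ω ∂P, X ω ≠ y := by simpa [ae_iff] using hX0 y
    filter_upwards [hne] with ω hω
    exact (hd _ (sub_ne_zero.2 hω.symm)).hasDerivAt.comp_sub_const y (X ω)

end Translates

/-! ### Convex functions of one variable with a critical point -/

section Convex

variable {G : ℝ → ℝ} {m : ℝ}

theorem le_of_hasDerivAt_zero (hG : ConvexOn ℝ Set.univ G) (hm : HasDerivAt G 0 m) (x : ℝ) :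
    G m ≤ G x := by
  rcases lt_trichotomy m x with h | rfl | h
  · have := hG.le_slope_of_hasDerivAt (Set.mem_univ m) (Set.mem_univ x) h hm
    rw [slope_def_field, le_div_iff₀ (sub_pos.2 h)] at this
    linarith
  · rfl
  · have := hG.slope_le_of_hasDerivAt (Set.mem_univ x) (Set.mem_univ m) h hm
    rw [slope_def_field, div_le_iff₀ (sub_pos.2 h)] at this
    linarith

theorem monotoneOn_Ici_of_hasDerivAt_zero (hG : ConvexOn ℝ Set.univ G) (hm : HasDerivAt G 0 m) :
    MonotoneOn G (Set.Ici m) := fun _ hx y _ hxy =>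
  (hG.le_max_of_mem_Icc (Set.mem_univ m) (Set.mem_univ y) ⟨hx, hxy⟩).trans
    (max_le (le_of_hasDerivAt_zero hG hm y) le_rfl)

/-- Only the part of `G` to the right of its minimizer `m` enters, and it is increasing. -/
theorem convexOn_comp_max (hG : ConvexOn ℝ Set.univ G) (hm : HasDerivAt G 0 m) :
    ConvexOn ℝ Set.univ fun s => G (max s m) := by
  refine ⟨convex_univ, fun x _ y _ α β hα hβ hαβ => ?_⟩
  have h1 := hG.2 (Set.mem_univ (max x m)) (Set.mem_univ (max y m)) hα hβ hαβ
  have h2 : max (α • x + β • y) m ≤ α • max x m + β • max y m := by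
    simp only [smul_eq_mul]
    refine max_le (by gcongr <;> exact le_max_left _ _) ?_
    calc m = α * m + β * m := by rw [← add_mul, hαβ, one_mul]
      _ ≤ _ := by gcongr <;> exact le_max_right _ _
  exact (monotoneOn_Ici_of_hasDerivAt_zero hG hm (Set.mem_Ici.2 (le_max_right _ _))
    (Set.mem_Ici.2 ((le_max_right _ _).trans h2)) h2).trans h1

/-- There is no kink at `s = m`, because the derivative of `G` vanishes there. -/
theorem differentiable_comp_max (hG : Differentiable ℝ G) (hm : HasDerivAt G 0 m) :
    Differentiable ℝ fun s => G (max s m) := by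
  intro s
  rcases lt_trichotomy s m with h | rfl | h
  · refine (differentiableAt_const (G m)).congr_of_eventuallyEq ?_
    filter_upwards [eventually_lt_nhds h] with x hx
    rw [max_eq_right hx.le]
  · refine HasDerivAt.differentiableAt (f' := 0) ?_
    rw [hasDerivAt_iff_isLittleO] at hm ⊢
    simp only [smul_zero, sub_zero, max_self] at hm ⊢
    have hcont : Filter.Tendsto (fun x : ℝ => max x s) (nhds s) (nhds s) := by
      have : Continuous fun x : ℝ => max x s := by fun_prop
      simpa using this.tendsto s
    refine (hm.comp_tendsto hcont).trans_le fun x => ?_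
    simpa using abs_max_sub_max_le_abs x s s
  · refine (hG s).congr_of_eventuallyEq ?_
    filter_upwards [eventually_gt_nhds h] with x hx
    rw [max_eq_left hx.le]

/-- Stopping the order at the minimizer `m` is optimal among all thresholds, whatever `s` is. -/
theorem comp_max_le_comp_max (hG : ConvexOn ℝ Set.univ G) (hm : HasDerivAt G 0 m) (r s : ℝ) :
    G (max s m) ≤ G (max s r) := by
  rcases le_total m s with h | h
  · rw [max_eq_left h]
    exact monotoneOn_Ici_of_hasDerivAt_zero hG hm h (h.trans (le_max_left _ _)) (le_max_left _ _)
  · rw [max_eq_right h]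
    exact le_of_hasDerivAt_zero hG hm _

/-- The loss from using the threshold `r` instead of the minimizer `m` is largest for `s` far to
the left; in particular it is bounded uniformly in `s`. -/
theorem comp_max_sub_comp_max_le (hG : ConvexOn ℝ Set.univ G) (hm : HasDerivAt G 0 m) (r s : ℝ) :
    G (max s r) - G (max s m) ≤ G r - G m := by
  have hmin := le_of_hasDerivAt_zero hG hm
  rcases le_total s r with hsr | hsr
  · rw [max_eq_right hsr]
    linarith [hmin (max s m)]
  · rw [max_eq_left hsr]
    rcases le_total m s with hms | hms
    · rw [max_eq_left hms]
      linarith [hmin r]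
    · rw [max_eq_right hms]
      have := (hG.le_max_of_mem_Icc (Set.mem_univ r) (Set.mem_univ m) ⟨hsr, hms⟩).trans
        (max_le le_rfl (hmin r))
      linarith

end Convex

/-! ### Regularity of the value functions -/

variable {Ω : Type*} [MeasurableSpace Ω] {P : Measure Ω} {H : ℕ} {wmax : ℝ} {W : ℕ → Ω → ℝ}
  {c b p : ℝ}

/-- From period `h` on, every level is a critical point of the cost of ordering up to it. -/
def IsStationaryFrom (P : Measure Ω) (W : ℕ → Ω → ℝ) (c b p : ℝ) (H : ℕ) (a : ℕ → ℝ) (h : ℕ) :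
    Prop :=
  ∀ t ∈ Finset.Ico h H, HasDerivAt (orderUpToCost P W c b p H a t) 0 (a t)

theorem IsStationaryFrom.mono {a : ℕ → ℝ} {h h' : ℕ} (ha : IsStationaryFrom P W c b p H a h)
    (hh : h ≤ h') : IsStationaryFrom P W c b p H a h' :=
  fun t ht => ha t (Finset.Ico_subset_Ico_left hh ht)

variable [IsProbabilityMeasure P]

theorem exists_lipschitzWith_holdingCost (b p : ℝ) : ∃ K, LipschitzWith K (holdingCost b p) := by
  refine ⟨‖b‖₊ + ‖p‖₊, LipschitzWith.of_dist_le_mul fun x y => ?_⟩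
  have h1 := abs_max_sub_max_le_abs x y 0
  have h2 := abs_max_sub_max_le_abs (-x) (-y) 0
  rw [neg_sub_neg, abs_sub_comm y x] at h2
  rw [Real.dist_eq, Real.dist_eq]
  push_cast
  calc |holdingCost b p x - holdingCost b p y|
      = |b * (max x 0 - max y 0) + p * (max (-x) 0 - max (-y) 0)| := by
        rw [holdingCost, holdingCost]; congr 1; ring
    _ ≤ |b| * |max x 0 - max y 0| + |p| * |max (-x) 0 - max (-y) 0| := by
        rw [← abs_mul, ← abs_mul]; exact abs_add_le _ _
    _ ≤ |b| * |x - y| + |p| * |x - y| := by gcongr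
    _ = _ := by simp only [Real.norm_eq_abs]; ring

theorem convexOn_holdingCost (hb : 0 ≤ b) (hp : 0 ≤ p) :
    ConvexOn ℝ Set.univ (holdingCost b p) := by
  have h1 : ConvexOn ℝ Set.univ fun x : ℝ => max x 0 :=
    (convexOn_id convex_univ).sup (convexOn_const 0 convex_univ)
  have h2 : ConvexOn ℝ Set.univ fun x : ℝ => max (-x) 0 :=
    (concaveOn_id convex_univ).neg.sup (convexOn_const 0 convex_univ)
  exact (h1.smul hb).add (h2.smul hp)

theorem differentiableAt_holdingCost {x : ℝ} (hx : x ≠ 0) :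
    DifferentiableAt ℝ (holdingCost b p) x := by
  rcases hx.lt_or_gt with h | h
  · have : DifferentiableAt ℝ (fun x : ℝ => p * -x) x := by fun_prop
    refine this.congr_of_eventuallyEq ?_
    filter_upwards [eventually_lt_nhds h] with y hy
    rw [holdingCost, max_eq_right hy.le, max_eq_left (by linarith)]; ring
  · have : DifferentiableAt ℝ (fun x : ℝ => b * x) x := by fun_prop
    refine this.congr_of_eventuallyEq ?_
    filter_upwards [eventually_gt_nhds h] with y hy
    rw [holdingCost, max_eq_left hy.le, max_eq_right (by linarith)]; ring

namespace IsDemand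

theorem integrable (hW : IsDemand P H wmax W) {h : ℕ} (hh : h ∈ Finset.Ico 1 H) :
    Integrable (W h) P := by
  refine Integrable.of_bound (hW.measurable h hh).aestronglyMeasurable wmax ?_
  filter_upwards [hW.mem_Icc h hh] with ω hω
  rw [Real.norm_eq_abs, abs_of_nonneg hω.1]
  exact hω.2

theorem exists_lipschitzWith_orderUpToCost (hW : IsDemand P H wmax W) (a : ℕ → ℝ) {h : ℕ}
    (hh : h ∈ Finset.Ico 1 H) (hE : ∃ K, LipschitzWith K (endCost P W c b p H a h)) :
    ∃ K, LipschitzWith K (orderUpToCost P W c b p H a h) := by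
  obtain ⟨K, hK⟩ := hE
  have hlin : LipschitzWith ‖c‖₊ fun y : ℝ => c * y := lipschitzWith_smul c
  exact ⟨_, hlin.add (lipschitzWith_integral_comp_const_sub (hW.integrable hh) hK)⟩

theorem exists_lipschitzWith_value (hW : IsDemand P H wmax W) (a : ℕ → ℝ) {h : ℕ} (hh : 1 ≤ h)
    (hH : h ≤ H) : ∃ K, LipschitzWith K (value P W c b p H a h) := by
  refine Nat.decreasingInduction' (P := fun k => ∃ K, LipschitzWith K (value P W c b p H a k))
    (fun k hk hhk ih => ?_) hH ⟨0, by
      simp only [funext (value_terminal (P := P) (W := W) (c := c) (b := b) (p := p) a)]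
      exact LipschitzWith.const _⟩
  have hkm : k ∈ Finset.Ico 1 H := Finset.mem_Ico.2 ⟨hh.trans hhk, hk⟩
  obtain ⟨K, hK⟩ := ih
  obtain ⟨K', hK'⟩ := exists_lipschitzWith_holdingCost b p
  obtain ⟨K₁, hK₁⟩ := hW.exists_lipschitzWith_orderUpToCost (c := c) a hkm ⟨_, hK'.add hK⟩
  have hlin : LipschitzWith ‖c‖₊ fun y : ℝ => c * y := lipschitzWith_smul c
  rw [funext (hW.value_eq a hkm)]
  exact ⟨_, (hK₁.comp (LipschitzWith.id.max_const (a k))).sub hlin⟩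

theorem exists_lipschitzWith_endCost (hW : IsDemand P H wmax W) (a : ℕ → ℝ) {h : ℕ}
    (hh : h ∈ Finset.Ico 1 H) : ∃ K, LipschitzWith K (endCost P W c b p H a h) := by
  obtain ⟨K, hK⟩ := hW.exists_lipschitzWith_value (c := c) (b := b) (p := p) a (h := h + 1)
    (by omega) (Finset.mem_Ico.1 hh).2
  obtain ⟨K', hK'⟩ := exists_lipschitzWith_holdingCost b p
  exact ⟨_, hK'.add hK⟩

theorem convexOn_differentiable_orderUpToCost_of_value (hW : IsDemand P H wmax W) (hb : 0 ≤ b)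
    (hp : 0 ≤ p) (a : ℕ → ℝ) {h : ℕ} (hh : h ∈ Finset.Ico 1 H)
    (hV : ConvexOn ℝ Set.univ (value P W c b p H a (h + 1)) ∧
      Differentiable ℝ (value P W c b p H a (h + 1))) :
    ConvexOn ℝ Set.univ (orderUpToCost P W c b p H a h) ∧
      Differentiable ℝ (orderUpToCost P W c b p H a h) := by
  obtain ⟨K, hK⟩ := hW.exists_lipschitzWith_endCost (c := c) (b := b) (p := p) a hh
  have hlin : ConvexOn ℝ Set.univ fun y : ℝ => c * y :=
    (LinearMap.mulLeft ℝ c).convexOn convex_univ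
  refine ⟨hlin.add (convexOn_integral_comp_const_sub (hW.integrable hh) hK
      ((convexOn_holdingCost hb hp).add hV.1)), ?_⟩
  have hint := differentiable_integral_comp_const_sub (hW.integrable hh)
    (hW.measure_eq_zero h hh) hK fun x hx => (differentiableAt_holdingCost hx).add (hV.2 x)
  exact (differentiable_id.const_mul c).add hint

/-- At stationary levels the derivative of the order-up-to cost vanishes where the cost-to-go
switches from a linear function to that cost, so the cost-to-go is convex and has no kink. -/
theorem convexOn_differentiable_value (hW : IsDemand P H wmax W) (hb : 0 ≤ b) (hp : 0 ≤ p)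
    {a : ℕ → ℝ} {h : ℕ} (hh : 1 ≤ h) (hH : h ≤ H) (ha : IsStationaryFrom P W c b p H a h) :
    ConvexOn ℝ Set.univ (value P W c b p H a h) ∧
      Differentiable ℝ (value P W c b p H a h) := by
  refine Nat.decreasingInduction' (P := fun k => ConvexOn ℝ Set.univ (value P W c b p H a k) ∧
    Differentiable ℝ (value P W c b p H a k)) (fun k hk hhk ih => ?_) hH ?_
  · have hkm : k ∈ Finset.Ico 1 H := Finset.mem_Ico.2 ⟨hh.trans hhk, hk⟩
    have hG := hW.convexOn_differentiable_orderUpToCost_of_value hb hp a hkm ih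
    have hk0 := ha k (Finset.mem_Ico.2 ⟨hhk, hk⟩)
    have hlin : ConcaveOn ℝ Set.univ fun y : ℝ => c * y :=
      (LinearMap.mulLeft ℝ c).concaveOn convex_univ
    rw [funext (hW.value_eq a hkm)]
    exact ⟨(convexOn_comp_max hG.1 hk0).sub hlin,
      (differentiable_comp_max hG.2 hk0).sub (differentiable_id.const_mul c)⟩
  · rw [funext (value_terminal (P := P) (W := W) (c := c) (b := b) (p := p) a)]
    exact ⟨convexOn_const 0 convex_univ, differentiable_const 0⟩

theorem convexOn_differentiable_orderUpToCost (hW : IsDemand P H wmax W) (hb : 0 ≤ b)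
    (hp : 0 ≤ p) {a : ℕ → ℝ} {h : ℕ} (hh : h ∈ Finset.Ico 1 H)
    (ha : IsStationaryFrom P W c b p H a (h + 1)) :
    ConvexOn ℝ Set.univ (orderUpToCost P W c b p H a h) ∧
      Differentiable ℝ (orderUpToCost P W c b p H a h) :=
  hW.convexOn_differentiable_orderUpToCost_of_value hb hp a hh
    (hW.convexOn_differentiable_value hb hp (by omega) (Finset.mem_Ico.1 hh).2 ha)

/-! ### Comparison of levels -/

theorem orderUpToCost_sub (hW : IsDemand P H wmax W) (a a' : ℕ → ℝ) {h : ℕ}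
    (hh : h ∈ Finset.Ico 1 H) (y : ℝ) :
    orderUpToCost P W c b p H a' h y - orderUpToCost P W c b p H a h y =
      ∫ ω, (value P W c b p H a' (h + 1) (y - W h ω) - value P W c b p H a (h + 1) (y - W h ω)) ∂P
      := by
  obtain ⟨K, hK⟩ := hW.exists_lipschitzWith_endCost (c := c) (b := b) (p := p) a hh
  obtain ⟨K', hK'⟩ := hW.exists_lipschitzWith_endCost (c := c) (b := b) (p := p) a' hh
  rw [orderUpToCost, orderUpToCost, add_sub_add_left_eq_sub,
    ← integral_sub (integrable_comp_const_sub (hW.integrable hh) hK' y)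
      (integrable_comp_const_sub (hW.integrable hh) hK y)]
  simp only [endCost, add_sub_add_left_eq_sub]

theorem orderUpToCost_sub_le (hW : IsDemand P H wmax W) (a a' : ℕ → ℝ) {h : ℕ}
    (hh : h ∈ Finset.Ico 1 H) (y : ℝ) {u : ℝ}
    (hu : ∀ x, value P W c b p H a' (h + 1) x - value P W c b p H a (h + 1) x ≤ u) :
    orderUpToCost P W c b p H a' h y - orderUpToCost P W c b p H a h y ≤ u := by
  obtain ⟨K, hK⟩ := hW.exists_lipschitzWith_value (c := c) (b := b) (p := p) a (h := h + 1)
    (by omega) (Finset.mem_Ico.1 hh).2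
  obtain ⟨K', hK'⟩ := hW.exists_lipschitzWith_value (c := c) (b := b) (p := p) a' (h := h + 1)
    (by omega) (Finset.mem_Ico.1 hh).2
  have hint := (integrable_comp_const_sub (hW.integrable hh) hK' y).sub
    (integrable_comp_const_sub (hW.integrable hh) hK y)
  rw [hW.orderUpToCost_sub a a' hh]
  simpa using integral_mono hint (integrable_const u) fun ω => hu (y - W h ω)

/-- Stationary levels are optimal from every initial inventory, and the excess cost of other
levels `a'` is at most the sum over the periods of the excess of the order-up-to cost at `a' t`. -/
theorem value_sub_mem_Icc (hW : IsDemand P H wmax W) (hb : 0 ≤ b) (hp : 0 ≤ p)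
    {a : ℕ → ℝ} (a' : ℕ → ℝ) {h : ℕ} (hh : 1 ≤ h) (hH : h ≤ H)
    (ha : IsStationaryFrom P W c b p H a h) (s : ℝ) :
    value P W c b p H a' h s - value P W c b p H a h s ∈ Set.Icc 0
      (∑ t ∈ Finset.Ico h H,
        (orderUpToCost P W c b p H a t (a' t) - orderUpToCost P W c b p H a t (a t))) := by
  refine Nat.decreasingInduction' (P := fun k => ∀ s,
    value P W c b p H a' k s - value P W c b p H a k s ∈ Set.Icc 0
      (∑ t ∈ Finset.Ico k H,
        (orderUpToCost P W c b p H a t (a' t) - orderUpToCost P W c b p H a t (a t))))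
    (fun k hk hhk ih s => ?_) hH (by simp [value_terminal]) s
  have hkm : k ∈ Finset.Ico 1 H := Finset.mem_Ico.2 ⟨hh.trans hhk, hk⟩
  have hG := (hW.convexOn_differentiable_orderUpToCost hb hp hkm (ha.mono (by omega))).1
  have hk0 := ha k (Finset.mem_Ico.2 ⟨hhk, hk⟩)
  have hlo := hW.orderUpToCost_sub_le a' a hkm (max s (a' k))
    fun x => sub_nonpos.2 (sub_nonneg.1 (ih x).1)
  have hup := hW.orderUpToCost_sub_le a a' hkm (max s (a' k)) fun x => (ih x).2
  have h2 := comp_max_le_comp_max hG hk0 (a' k) s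
  have h3 := comp_max_sub_comp_max_le hG hk0 (a' k) s
  rw [hW.value_eq a hkm, hW.value_eq a' hkm, Finset.sum_eq_sum_Ico_succ_bot hk]
  exact ⟨by linarith, by linarith⟩

end IsDemand

end Newsvendor

namespace Newsvendor

/-! ### Changing a single level -/

/-- Moving `m` by `-ε * g`, against the derivative `g`, never increases `G (max s ·)` by more than
a quantity of smaller order than `ε`, and it decreases `G (max s ·)` by `ε * g ^ 2`, up to such a
quantity, when `s` is well below `m`. -/
theorem eventually_comp_max_sub_le {G : ℝ → ℝ} {g m : ℝ} (hG : HasDerivAt G g m) {η : ℝ}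
    (hη : 0 < η) : ∀ᶠ ε in nhdsWithin (0 : ℝ) (Set.Ioi 0),
      (∀ s, G (max s (m - ε * g)) - G (max s m) ≤ 2 * η * (ε * |g|)) ∧
      ∀ s < m - 1, G (max s (m - ε * g)) - G (max s m) ≤ 2 * η * (ε * |g|) - ε * g ^ 2 := by
  obtain ⟨δ, hδ, hball⟩ := Metric.eventually_nhds_iff.1 ((hasDerivAt_iff_isLittleO.1 hG).def hη)
  have hsmall : ∀ᶠ ε in nhdsWithin (0 : ℝ) (Set.Ioi 0), ε * |g| < min δ 1 := by
    have hcont : Filter.Tendsto (fun ε : ℝ => ε * |g|) (nhds 0) (nhds 0) := by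
      have : Continuous fun ε : ℝ => ε * |g| := by fun_prop
      simpa using this.tendsto 0
    exact (hcont.eventually_lt_const (lt_min hδ one_pos)).filter_mono nhdsWithin_le_nhds
  filter_upwards [hsmall, self_mem_nhdsWithin] with ε hε hε0
  have hε0 : 0 < ε := hε0
  have hεδ := hε.trans_le (min_le_left _ _)
  have hε1 := hε.trans_le (min_le_right _ _)
  have hnn : 0 ≤ ε * |g| := by positivity
  have habs : |ε * g| = ε * |g| := by rw [abs_mul, abs_of_pos hε0]
  have hlin {x : ℝ} (hx : |x - m| ≤ ε * |g|) : |G x - G m - g * (x - m)| ≤ η * (ε * |g|) := by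
    have := hball (y := x) (by rw [Real.dist_eq]; exact hx.trans_lt hεδ)
    rw [smul_eq_mul, Real.norm_eq_abs, Real.norm_eq_abs, mul_comm (x - m)] at this
    exact this.trans (by gcongr)
  have hr : |m - ε * g - m| ≤ ε * |g| := by rw [sub_sub_cancel_left, abs_neg, habs]
  have hm : |m - m| ≤ ε * |g| := by rwa [sub_self, abs_zero]
  constructor
  · intro s
    -- Unless the two maxima agree, both lie within `ε * |g|` of `m`, where `G` is almost linear.
    by_cases hxy : max s (m - ε * g) = max s m
    · rw [hxy, sub_self]; positivity
    have hs : s ≤ max (m - ε * g) m := by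
      by_contra! hs
      exact hxy (by rw [max_eq_left ((le_max_left _ _).trans hs.le),
        max_eq_left ((le_max_right _ _).trans hs.le)])
    have hb := abs_le.1 habs.le
    have hx : |max s (m - ε * g) - m| ≤ ε * |g| := by
      refine abs_le.2 ⟨by linarith [le_max_right s (m - ε * g)], ?_⟩
      rw [sub_le_iff_le_add]
      exact max_le (hs.trans (max_le (by linarith) (by linarith))) (by linarith)
    have hy : |max s m - m| ≤ ε * |g| := by
      refine abs_le.2 ⟨by linarith [le_max_right s m], ?_⟩
      rw [sub_le_iff_le_add]
      exact max_le (hs.trans (max_le (by linarith) (by linarith))) (by linarith)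
    have hsign : g * (max s (m - ε * g) - max s m) ≤ 0 := by
      rcases le_total 0 g with hg | hg
      · refine mul_nonpos_of_nonneg_of_nonpos hg (sub_nonpos.2 (max_le_max le_rfl ?_))
        linarith [mul_nonneg hε0.le hg]
      · refine mul_nonpos_of_nonpos_of_nonneg hg (sub_nonneg.2 (max_le_max le_rfl ?_))
        linarith [mul_nonpos_of_nonneg_of_nonpos hε0.le hg]
    linarith [(abs_le.1 (hlin hx)).2, (abs_le.1 (hlin hy)).1]
  · intro s hs
    have hb := abs_le.1 habs.le
    rw [max_eq_right (by linarith), max_eq_right (by linarith)]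
    have h1 := (abs_le.1 (hlin hr)).2
    have h2 : 0 ≤ η * (ε * |g|) := by positivity
    linarith

variable {Ω : Type*} [MeasurableSpace Ω] {P : Measure Ω} {H : ℕ} {wmax : ℝ} {W : ℕ → Ω → ℝ}
  {c b p : ℝ}

theorem value_update_of_lt (a : ℕ → ℝ) (r s : ℝ) {t h : ℕ} (hth : t < h) :
    value P W c b p H (Function.update a t r) h s = value P W c b p H a h s :=
  value_congr s fun i hi => Function.update_of_ne (by have := Finset.mem_Ico.1 hi; omega) _ _

theorem orderUpToCost_update (a : ℕ → ℝ) (r y : ℝ) (t : ℕ) :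
    orderUpToCost P W c b p H (Function.update a t r) t y = orderUpToCost P W c b p H a t y := by
  simp only [orderUpToCost, endCost, value_update_of_lt a r _ t.lt_succ_self]

namespace IsDemand

variable [IsProbabilityMeasure P]

theorem value_update_sub (hW : IsDemand P H wmax W) (a : ℕ → ℝ) (r s : ℝ) {t : ℕ}
    (ht : t ∈ Finset.Ico 1 H) :
    value P W c b p H (Function.update a t r) t s - value P W c b p H a t s =
      orderUpToCost P W c b p H a t (max s r) - orderUpToCost P W c b p H a t (max s (a t)) := by
  rw [hW.value_eq _ ht, hW.value_eq _ ht, orderUpToCost_update, Function.update_self]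
  ring

theorem value_update_sub_le (hW : IsDemand P H wmax W) (a : ℕ → ℝ) (r : ℝ) {t : ℕ}
    (ht : t ∈ Finset.Ico 1 H) {u : ℝ}
    (hu : ∀ s, orderUpToCost P W c b p H a t (max s r)
      - orderUpToCost P W c b p H a t (max s (a t)) ≤ u) {h : ℕ} (hh : 1 ≤ h) (hht : h ≤ t)
    (s : ℝ) : value P W c b p H (Function.update a t r) h s - value P W c b p H a h s ≤ u := by
  refine Nat.decreasingInduction' (P := fun k => ∀ s,
    value P W c b p H (Function.update a t r) k s - value P W c b p H a k s ≤ u)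
    (fun k hk hhk ih s => ?_) hht (fun s => (hW.value_update_sub a r s ht).trans_le (hu s)) s
  have hkm : k ∈ Finset.Ico 1 H :=
    Finset.mem_Ico.2 ⟨hh.trans hhk, hk.trans (Finset.mem_Ico.1 ht).2⟩
  rw [hW.value_eq _ hkm, hW.value_eq _ hkm, Function.update_of_ne hk.ne, sub_sub_sub_cancel_right]
  exact hW.orderUpToCost_sub_le _ _ hkm _ ih

end IsDemand

/-! ### The loss -/

theorem loss_eq (ρ : Measure (Finset.Icc 1 H × ℝ)) (θ : EuclideanSpace ℝ (Finset.Icc 1 H)) :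
    loss P W c b p ρ θ = ∫ z, value P W c b p H (level θ) z.1 z.2 ∂ρ := rfl

/-- The initial inventory has a finite first moment in each period, so a family of Lipschitz
functions of it, indexed by the initial period, is integrable. -/
theorem integrable_of_lipschitzWith {ρ : Measure (Finset.Icc 1 H × ℝ)} [IsFiniteMeasure ρ]
    (hρ : ∀ h : Finset.Icc 1 H, Integrable (fun s : ℝ => s) (periodMarginal ρ h))
    {f : Finset.Icc 1 H → ℝ → ℝ} (hf : ∀ h, ∃ K, LipschitzWith K (f h)) :
    Integrable (fun z => f z.1 z.2) ρ := by
  have hcover : (⋃ h : Finset.Icc 1 H, {z : Finset.Icc 1 H × ℝ | z.1 = h}) = Set.univ := by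
    ext z; simp
  rw [← integrableOn_univ, ← hcover, integrableOn_finite_iUnion]
  intro h
  obtain ⟨K, hK⟩ := hf h
  have hfin : IsFiniteMeasure (periodMarginal ρ h) := by unfold periodMarginal; infer_instance
  have hint : Integrable (f h) ((ρ.restrict {z | z.1 = h}).map Prod.snd) := by
    simpa [periodMarginal, Measure.snd] using integrable_comp_const_sub (hρ h).neg hK 0
  have hsnd := (integrable_map_measure hint.aestronglyMeasurable measurable_snd.aemeasurable).1 hint
  refine hsnd.congr ?_
  have hmeas : MeasurableSet {z : Finset.Icc 1 H × ℝ | z.1 = h} :=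
    measurable_fst (measurableSet_singleton h)
  filter_upwards [ae_restrict_mem hmeas] with z hz
  have hz : z.1 = h := hz
  rw [hz, Function.comp_apply]

theorem abs_level_sub_le (θ θ' : EuclideanSpace ℝ (Finset.Icc 1 H)) (t : ℕ) :
    |level θ' t - level θ t| ≤ ‖θ' - θ‖ := by
  by_cases ht : t ∈ Finset.Icc 1 H
  · simpa [level, ht] using PiLp.norm_apply_le (θ' - θ) ⟨t, ht⟩
  · simp [level, ht]

theorem level_add_single (θ : EuclideanSpace ℝ (Finset.Icc 1 H)) (t : Finset.Icc 1 H) (x : ℝ) :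
    level (θ + EuclideanSpace.single t x) = Function.update (level θ) t (level θ t + x) := by
  ext i
  by_cases hi : i ∈ Finset.Icc 1 H
  · by_cases hit : i = t
    · subst hit
      simp [level]
    · have hne : (⟨i, hi⟩ : Finset.Icc 1 H) ≠ t := fun h => hit (congrArg Subtype.val h)
      simp [level, hi, Function.update_of_ne hit, hne]
  · have hit : i ≠ t := fun h => hi (h ▸ t.2)
    simp [level, hi, Function.update_of_ne hit]

namespace IsDemand

variable [IsProbabilityMeasure P] {ρ : Measure (Finset.Icc 1 H × ℝ)} [IsProbabilityMeasure ρ]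

theorem integrable_value (hW : IsDemand P H wmax W)
    (hρ : ∀ h : Finset.Icc 1 H, Integrable (fun s : ℝ => s) (periodMarginal ρ h)) (a : ℕ → ℝ) :
    Integrable (fun z : Finset.Icc 1 H × ℝ => value P W c b p H a z.1 z.2) ρ :=
  integrable_of_lipschitzWith hρ fun h =>
    hW.exists_lipschitzWith_value a (Finset.mem_Icc.1 h.2).1 (Finset.mem_Icc.1 h.2).2

/-- The lower bound says that stationary levels are optimal, the upper bound that the loss is flat
at them. -/
theorem loss_sub_mem_Icc (hW : IsDemand P H wmax W) (hb : 0 ≤ b) (hp : 0 ≤ p)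
    (hρ : ∀ h : Finset.Icc 1 H, Integrable (fun s : ℝ => s) (periodMarginal ρ h))
    {θ : EuclideanSpace ℝ (Finset.Icc 1 H)} (hθ : IsStationaryFrom P W c b p H (level θ) 1)
    (θ' : EuclideanSpace ℝ (Finset.Icc 1 H)) :
    loss P W c b p ρ θ' - loss P W c b p ρ θ ∈ Set.Icc 0
      (∑ t ∈ Finset.Ico 1 H, (orderUpToCost P W c b p H (level θ) t (level θ' t)
        - orderUpToCost P W c b p H (level θ) t (level θ t))) := by
  have hi := hW.integrable_value (c := c) (b := b) (p := p) hρ (level θ)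
  have hi' := hW.integrable_value (c := c) (b := b) (p := p) hρ (level θ')
  have hmem (z : Finset.Icc 1 H × ℝ) := hW.value_sub_mem_Icc hb hp (level θ')
    (Finset.mem_Icc.1 z.1.2).1 (Finset.mem_Icc.1 z.1.2).2
    (hθ.mono (Finset.mem_Icc.1 z.1.2).1) z.2
  rw [loss_eq, loss_eq, ← integral_sub hi' hi]
  refine ⟨integral_nonneg fun z => (hmem z).1, ?_⟩
  have hmono := integral_mono (hi'.sub hi) (integrable_const (∑ t ∈ Finset.Ico 1 H,
    (orderUpToCost P W c b p H (level θ) t (level θ' t)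
      - orderUpToCost P W c b p H (level θ) t (level θ t)))) fun z => (hmem z).2.trans ?_
  · rwa [integral_const, probReal_univ, one_smul] at hmono
  refine Finset.sum_le_sum_of_subset_of_nonneg
    (Finset.Ico_subset_Ico_left (Finset.mem_Icc.1 z.1.2).1) fun t ht _ => sub_nonneg.2 ?_
  have hG := hW.convexOn_differentiable_orderUpToCost hb hp ht (hθ.mono (by omega))
  exact le_of_hasDerivAt_zero hG.1 (hθ t ht) _

/-- The loss need not be differentiable elsewhere, since `ρ` may have atoms; at stationary levels
its increments are squeezed between zero and a sum of functions of one variable with derivative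
zero. -/
theorem hasGradientAt_loss_zero (hW : IsDemand P H wmax W) (hb : 0 ≤ b) (hp : 0 ≤ p)
    (hρ : ∀ h : Finset.Icc 1 H, Integrable (fun s : ℝ => s) (periodMarginal ρ h))
    {θ : EuclideanSpace ℝ (Finset.Icc 1 H)} (hθ : IsStationaryFrom P W c b p H (level θ) 1) :
    HasGradientAt (loss P W c b p ρ) 0 θ := by
  rw [hasGradientAt_iff_isLittleO]
  simp only [inner_zero_left, sub_zero]
  have hsum : (fun θ' => ∑ t ∈ Finset.Ico 1 H, (orderUpToCost P W c b p H (level θ) t (level θ' t)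
      - orderUpToCost P W c b p H (level θ) t (level θ t))) =o[nhds θ] fun θ' => θ' - θ := by
    refine Asymptotics.IsLittleO.fun_sum fun t ht => ?_
    have hd := hasDerivAt_iff_isLittleO.1 (hθ t ht)
    simp only [smul_zero, sub_zero] at hd
    have htend : Filter.Tendsto (fun θ' => level θ' t) (nhds θ) (nhds (level θ t)) := by
      rw [tendsto_iff_dist_tendsto_zero]
      exact squeeze_zero (fun _ => dist_nonneg) (fun θ' => abs_level_sub_le θ θ' t)
        (tendsto_iff_norm_sub_tendsto_zero.1 Filter.tendsto_id)
    exact (hd.comp_tendsto htend).trans_le fun θ' => abs_level_sub_le θ θ' t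
  refine (Asymptotics.IsBigO.of_norm_le fun θ' => ?_).trans_isLittleO hsum
  have hmem := hW.loss_sub_mem_Icc hb hp hρ hθ θ'
  rw [Real.norm_of_nonneg hmem.1]
  exact hmem.2

/-- If near `θ` the loss decreases at most sublinearly, then `θ` is stationary: working backwards
in time, a nonzero derivative of the order-up-to cost of period `t` would allow a linear decrease
of the loss, because with positive probability the process starts in period `t` well below
`θ_t`. -/
theorem isStationaryFrom_of_loss (hW : IsDemand P H wmax W) (hb : 0 ≤ b) (hp : 0 ≤ p)
    [ρ.IsOpenPosMeasure]
    (hρ : ∀ h : Finset.Icc 1 H, Integrable (fun s : ℝ => s) (periodMarginal ρ h))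
    {θ : EuclideanSpace ℝ (Finset.Icc 1 H)}
    (hθ : ∀ κ > 0, ∀ᶠ θ' in nhds θ,
      -(κ * ‖θ' - θ‖) ≤ loss P W c b p ρ θ' - loss P W c b p ρ θ) :
    IsStationaryFrom P W c b p H (level θ) 1 := by
  rcases Nat.lt_or_ge H 1 with hH | hH
  · intro t ht
    have := Finset.mem_Ico.1 ht
    omega
  refine Nat.decreasingInduction' (P := fun k => IsStationaryFrom P W c b p H (level θ) k)
    (fun t htH h1t ih => ?_) hH (by simp [IsStationaryFrom])
  have htm : t ∈ Finset.Ico 1 H := Finset.mem_Ico.2 ⟨h1t, htH⟩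
  let t' : Finset.Icc 1 H := ⟨t, Finset.mem_Icc.2 ⟨h1t, htH.le⟩⟩
  set m := level θ t with hm
  set G := orderUpToCost P W c b p H (level θ) t with hGdef
  have hG : HasDerivAt G (deriv G m) m :=
    ((hW.convexOn_differentiable_orderUpToCost hb hp htm ih).2 m).hasDerivAt
  suffices h0 : deriv G m = 0 by
    intro i hi
    rcases (Finset.mem_Ico.1 hi).1.eq_or_lt with rfl | hlt
    · rwa [h0] at hG
    · exact ih i (Finset.mem_Ico.2 ⟨hlt, (Finset.mem_Ico.1 hi).2⟩)
  set g := deriv G m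
  by_contra hg
  have hg0 : 0 < |g| := abs_pos.2 hg
  let A : Set (Finset.Icc 1 H × ℝ) := {z | z.1 = t' ∧ z.2 < m - 1}
  have hAo : IsOpen A :=
    ((isOpen_discrete {t'}).preimage continuous_fst).inter (isOpen_Iio.preimage continuous_snd)
  have hA : 0 < ρ.real A := by
    rw [measureReal_def]
    exact ENNReal.toReal_pos (hAo.measure_pos ρ ⟨(t', m - 2), rfl, by simp⟩).ne'
      (measure_ne_top _ _)
  set q := ρ.real A
  -- The gain is `ε * g ^ 2 * q`; these constants make the error terms `ε * g ^ 2 * q / 4` each.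
  have hκ : 0 < |g| * q / 4 := by positivity
  have hη : 0 < |g| * q / 8 := by positivity
  have hnorm (ε : ℝ) : ‖θ + EuclideanSpace.single t' (-(ε * g)) - θ‖ = |ε * g| := by
    rw [add_sub_cancel_left, PiLp.norm_single, norm_neg, Real.norm_eq_abs]
  have htend : Filter.Tendsto (fun ε : ℝ => θ + EuclideanSpace.single t' (-(ε * g)))
      (nhdsWithin 0 (Set.Ioi 0)) (nhds θ) := by
    rw [tendsto_iff_norm_sub_tendsto_zero]
    simp only [hnorm]
    have hc : Continuous fun ε : ℝ => |ε * g| := by fun_prop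
    simpa using (hc.tendsto 0).mono_left (nhdsWithin_le_nhds (s := Set.Ioi 0))
  obtain ⟨ε, ⟨⟨hD, hDA⟩, hloss⟩, hε⟩ := ((eventually_comp_max_sub_le hG hη).and
    (htend.eventually (hθ _ hκ))).and self_mem_nhdsWithin |>.exists
  have hε : 0 < ε := hε
  rw [hnorm, abs_mul, abs_of_pos hε, loss_eq, loss_eq, level_add_single] at hloss
  have hi := hW.integrable_value (c := c) (b := b) (p := p) hρ (level θ)
  have hi' := hW.integrable_value (c := c) (b := b) (p := p) hρ
    (Function.update (level θ) t (m - ε * g))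
  have hbound (z : Finset.Icc 1 H × ℝ) :
      value P W c b p H (Function.update (level θ) t (m - ε * g)) z.1 z.2
        - value P W c b p H (level θ) z.1 z.2
      ≤ 2 * (|g| * q / 8) * (ε * |g|) - A.indicator (fun _ => ε * g ^ 2) z := by
    by_cases hzA : z ∈ A
    · rw [Set.indicator_of_mem hzA, hzA.1, hW.value_update_sub _ _ _ htm]
      exact hDA _ hzA.2
    · rw [Set.indicator_of_notMem hzA, sub_zero]
      rcases le_or_gt (z.1 : ℕ) t with hzt | hzt
      · exact hW.value_update_sub_le _ _ htm hD (Finset.mem_Icc.1 z.1.2).1 hzt _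
      · rw [value_update_of_lt _ _ _ hzt, sub_self]
        positivity
  have hindi : Integrable (A.indicator fun _ => ε * g ^ 2) ρ :=
    (integrable_const _).indicator hAo.measurableSet
  have hint := integral_mono (hi'.sub hi) ((integrable_const _).sub hindi) hbound
  rw [integral_sub' (integrable_const _) hindi, integral_indicator_const _ hAo.measurableSet] at hint
  simp only [Pi.sub_apply] at hint
  rw [integral_sub hi' hi] at hint
  have hle := hloss.trans hint
  simp only [integral_const, probReal_univ, smul_eq_mul] at hle
  have hsq : g ^ 2 = |g| * |g| := by rw [← sq, sq_abs]
  have hpos : 0 < q * ε * (|g| * |g|) := by positivity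
  rw [hsq] at hle
  nlinarith

end IsDemand

end Newsvendor

end

theorem mainTheorem6 {Ω : Type*} [MeasurableSpace Ω] (P : Measure Ω) [IsProbabilityMeasure P]
    (H : ℕ) (c b p wmax : ℝ) (hc : 0 < c) (hb : 0 < b) (hp : c < p)
    (W : ℕ → Ω → ℝ)
    (hW_meas : ∀ t ∈ Finset.Ico 1 H, Measurable (W t))
    (hW_bdd : ∀ t ∈ Finset.Ico 1 H, ∀ᵐ ω ∂P, W t ω ∈ Set.Icc 0 wmax)
    (hW_cont : ∀ t ∈ Finset.Ico 1 H, ∀ x : ℝ, P {ω | W t ω = x} = 0)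
    (hW_indep : iIndepFun (fun (t : Finset.Ico 1 H) => W t) P)
    (ρ : Measure (Finset.Icc 1 H × ℝ)) [IsProbabilityMeasure ρ]
    [ρ.IsOpenPosMeasure]
    (hρ_mom : ∀ (h : Finset.Icc 1 H) (n : ℕ),
      Integrable (fun s : ℝ => s ^ n) (Newsvendor.periodMarginal ρ h))
    (θ : EuclideanSpace ℝ (Finset.Icc 1 H)) :
    HasGradientAt (Newsvendor.loss P W c b p ρ) 0 θ ↔
      ∀ θ' : EuclideanSpace ℝ (Finset.Icc 1 H),
        Newsvendor.loss P W c b p ρ θ ≤ Newsvendor.loss P W c b p ρ θ' := by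
  have hW : Newsvendor.IsDemand P H wmax W := ⟨hW_meas, hW_bdd, hW_cont, hW_indep⟩
  have hp0 : 0 ≤ p := (hc.trans hp).le
  have hρ (h : Finset.Icc 1 H) :
      Integrable (fun s : ℝ => s) (Newsvendor.periodMarginal ρ h) := by
    simpa using hρ_mom h 1
  constructor
  · intro hgrad
    have hstat := hW.isStationaryFrom_of_loss hb.le hp0 hρ (θ := θ) (c := c) fun κ hκ => by
      have hlo := hasGradientAt_iff_isLittleO.1 hgrad
      simp only [inner_zero_left, sub_zero] at hlo
      filter_upwards [hlo.def hκ] with θ' hθ'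
      exact (abs_le.1 hθ').1
    exact fun θ' => sub_nonneg.1 (hW.loss_sub_mem_Icc hb.le hp0 hρ hstat θ').1
  · intro hmin
    refine hW.hasGradientAt_loss_zero hb.le hp0 hρ
      (hW.isStationaryFrom_of_loss hb.le hp0 hρ fun κ hκ => .of_forall fun θ' => ?_)
    have h1 : 0 ≤ κ * ‖θ' - θ‖ := by positivity
    linarith [hmin θ']
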